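/- Let $\kappa\in\mathbb{N}=\{1,2,3,\dots\}$, let $\psi\colon\mathbb{R}\to(0,\infty)$ be a continuous even function, and let $\mu_\rho$ be the Borel measure on $\mathbb{R}^\kappa$ with density $\rho(x)=\psi(\|x\|)^{-1}$ with respect to Lebesgue measure, where $\|\cdot\|$ is the Euclidean norm. Let $A$ be an invertible linear transformation of $\mathbb{R}^\kappa$ with operator norm $\|A\|=1$ and let $I$ be the identity. For $a\in\mathbb{R}^\kappa$ let $C_{A+a,\rho}$ be the composition operator $f\mapsto f\circ(A+a)$ in the complex Hilbert space $L^2(\mu_\rho)$, where $(A+a)(x)=Ax+a$. Assume that $\psi$ belongs to the class $\mathscr{H}$, that is, $\psi$ is the restriction to $\mathbb{R}$ of an entire function $\Phi$ of the form $\Phi(z)=\alpha_0+\sum_{n=k}^\infty\alpha_n z^n$ for some integer $k\ge 1$, with $\alpha_0\ge 0$, $\alpha_k>0$ and $\alpha_n\ge 0$ for all $n\ge k+1$; and assume that $\limsup_{x\to\infty}\psi'(x)/\psi(x)<\infty$. Then for every $a\in\ker(I-A)$, $C_{A+a,\rho}$ is a bounded operator defined on all of $L^2(\mu_\rho)$.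 Moreover, if one of the following conditions holds: (i) there is a sequence $\{a_k\}_{k=1}^\infty\subseteq\ker(I-A)\setminus\{0\}$ such that $\frac{1}{k\|a_k\|}\in\mathbb{N}$ and $C_{A+a_k,\rho}$ is cosubnormal for every $k\in\mathbb{N}$, (ii) there are $\varepsilon>0$ and $a_0\in\ker(I-A)\setminus\{0\}$ such that $C_{A+ta_0,\rho}$ is cosubnormal for every $t\in\mathbb{R}$ with $0<|t|<\varepsilon$, then $\psi$ is the hyperbolic cosine transform of a compactly supported Borel measure $\nu$ on $[0,\infty)$, that is, $\psi(x)=\int_{[0,\infty)}\cosh(xu)\,d\nu(u)$ (a finite integral) for all $x\in\mathbb{R}$. Here a bounded operator on a complex Hilbert space is cosubnormal if its adjoint is subnormal, i.e. the adjoint is the restriction of a bounded normal operator on some Hilbert space containing the given one isometrically. -/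

import Mathlib

open MeasureTheory Filter
open scoped NNReal ENNReal

/-- A bounded operator `S` on a complex Hilbert space `H` is subnormal if it has a normal extension:
`H` embeds isometrically in a complex Hilbert space `K` carrying a bounded normal operator `N` that
extends `S`. -/
def IsSubnormalOp.{u} {H : Type u} [NormedAddCommGroup H] [InnerProductSpace ℂ H]
    (S : H →L[ℂ] H) : Prop :=
  ∃ (K : Type u) (_ : NormedAddCommGroup K) (_ : InnerProductSpace ℂ K) (_ : CompleteSpace K)
    (N : K →L[ℂ] K) (V : H →ₗᵢ[ℂ] K), IsStarNormal N ∧ ∀ h : H, V (S h) = N (V h)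

/-- A bounded operator on a complex Hilbert space is cosubnormal if its adjoint is subnormal. -/
def IsCosubnormalOp.{u} {H : Type u} [NormedAddCommGroup H] [InnerProductSpace ℂ H]
    [CompleteSpace H] (S : H →L[ℂ] H) : Prop :=
  IsSubnormalOp (ContinuousLinearMap.adjoint S)

/-- The bounded operator `C` on `L²(μ)` is the composition operator `f ↦ f ∘ T`: it maps the class
of every square integrable `f` to the class of `f ∘ T`. -/
def IsCompositionOp {X : Type*} [MeasurableSpace X] (μ : Measure X) (T : X → X)
    (C : Lp ℂ 2 μ →L[ℂ] Lp ℂ 2 μ) : Prop :=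
  ∀ (f : X → ℂ) (hf : MemLp f 2 μ), (C (hf.toLp f) : X → ℂ) =ᵐ[μ] f ∘ T

/-- The measure `ρ dV` on `ℝ^κ`, where `V` is Lebesgue measure and `ρ(x) = ψ(‖x‖)⁻¹`. -/
noncomputable def radialMeasure (κ : ℕ) (ψ : ℝ → ℝ) : Measure (EuclideanSpace ℝ (Fin κ)) :=
  volume.withDensity fun x => ENNReal.ofReal (ψ ‖x‖)⁻¹

/-- The composition operator with the affine symbol `x ↦ A x + a` is a bounded operator, defined on
all of `L²(ρ dV)`. -/
def BoundedAffineComposition {κ : ℕ} (ψ : ℝ → ℝ)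
    (A : EuclideanSpace ℝ (Fin κ) →L[ℝ] EuclideanSpace ℝ (Fin κ))
    (a : EuclideanSpace ℝ (Fin κ)) : Prop :=
  ∃ C : Lp ℂ 2 (radialMeasure κ ψ) →L[ℂ] Lp ℂ 2 (radialMeasure κ ψ),
    IsCompositionOp (radialMeasure κ ψ) (fun x => A x + a) C

/-- The composition operator with the affine symbol `x ↦ A x + a` is a bounded cosubnormal operator
on `L²(ρ dV)`. -/
def CosubnormalAffineComposition {κ : ℕ} (ψ : ℝ → ℝ)
    (A : EuclideanSpace ℝ (Fin κ) →L[ℝ] EuclideanSpace ℝ (Fin κ))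
    (a : EuclideanSpace ℝ (Fin κ)) : Prop :=
  ∃ C : Lp ℂ 2 (radialMeasure κ ψ) →L[ℂ] Lp ℂ 2 (radialMeasure κ ψ),
    IsCompositionOp (radialMeasure κ ψ) (fun x => A x + a) C ∧ IsCosubnormalOp C

/-- The class `𝓗_k` (`k ≥ 1`): entire functions `Φ(z) = α₀ + ∑_{n ≥ k} αₙ zⁿ` with `α₀ ≥ 0`,
`α_k > 0` and `αₙ ≥ 0` for all `n > k`. -/
def entireClassOrder (k : ℕ) : Set (ℂ → ℂ) :=
  {Φ | ∃ α : ℕ → ℝ, 0 ≤ α 0 ∧ (∀ n, 1 ≤ n → n < k → α n = 0) ∧ 0 < α k ∧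
    (∀ n, k + 1 ≤ n → 0 ≤ α n) ∧ ∀ z : ℂ, HasSum (fun n : ℕ => (α n : ℂ) * z ^ n) (Φ z)}

/-- The class `𝓗 = ⋃_{k ≥ 1} 𝓗_k`. -/
def entireClass : Set (ℂ → ℂ) :=
  {Φ | ∃ k : ℕ, 1 ≤ k ∧ Φ ∈ entireClassOrder k}

/-- A function on the real line belongs to `𝓗` if it has an extension to an entire function in
`𝓗`. -/
def MemEntireClass (ψ : ℝ → ℝ) : Prop :=
  ∃ Φ ∈ entireClass, ∀ x : ℝ, Φ (x : ℂ) = (ψ x : ℂ)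

/-- `ψ` is the hyperbolic cosine transform of a compactly supported Borel measure on
`ℝ₊ = [0, ∞)`. -/
def IsCompactCoshTransform (ψ : ℝ → ℝ) : Prop :=
  ∃ ν : Measure ℝ≥0, (∃ K : Set ℝ≥0, IsCompact K ∧ ν Kᶜ = 0) ∧
    ∀ x : ℝ, Integrable (fun u : ℝ≥0 => Real.cosh (x * u)) ν ∧
      ψ x = ∫ u : ℝ≥0, Real.cosh (x * u) ∂ν

/-- For a sequence `a₁, a₂, …` of nonzero vectors, `a_k ⇝ 0` means that `1 / (k ‖a_k‖)` is a
positive integer for every `k ≥ 1`. (The value at index `0` plays no role.) -/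
def SquigglyToZero {E : Type*} [NormedAddCommGroup E] (a : ℕ → E) : Prop :=
  ∀ k : ℕ, 1 ≤ k → ∃ s : ℕ, 1 ≤ s ∧ 1 / ((k : ℝ) * ‖a k‖) = (s : ℝ)

/-! Call a real sequence `m` positive definite if the functional `X ^ n ↦ m n` on polynomials is
nonnegative on squares.

Boundedness: the bound on `ψ' / ψ` and the monotonicity of `ψ` on the half-line give `ψ (x + ‖a‖) ≤
K * ψ x` for `x ≥ 0`. Since `‖A x + a‖ ≤ ‖x‖ + ‖a‖`, the density at `x` is at most `K` times the
density at `A x + a`, and a linear change of variables finishes.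

Cosh transform: if `T` has a normal extension `N`, then `‖T ^ n f‖ ^ 2 = ⟪(N* N) ^ n f, f⟫`, which
is positive definite in `n`. For `T` the adjoint of the composition operator and `f` the indicator
of a ball `B` around `0`, this number is the integral over `B` of `c ^ n * ψ ‖θ^n x‖ / ψ ‖x‖`, where
`θ x = A x + a` and `c = |det A|⁻¹`. Shrinking `B` to `0`, where `θ^n 0 = n a` because `A a = a`,
shows that `n ↦ ψ (n ‖a‖)` is positive definite
(`CosubnormalAffineComposition.momentFunctional_nonneg`).

Both (i) and (ii) provide such `a` with `h = ‖a‖` arbitrarily small. Substituting `(X - 1) / h` for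
`X` turns moments into divided differences, so in the limit the derivatives `n! * α n` of `ψ` at `0`
are positive definite (`momentFunctional_factorial_mul_nonneg`). They grow at most geometrically
(`exists_factorial_mul_le`), hence are the moments of a finite measure on some `[-R, R]`. Summing
the Taylor series gives `ψ x = ∫ exp (x t)`, and evenness replaces `exp` by `cosh`. -/

/-! ### Moment problems on compact intervals -/

section MomentFunctional
open Polynomial

/-- The Cauchy–Schwarz inequality for a linear functional that is nonnegative on squares. -/
lemma sq_apply_mul_le (L : ℝ[X] →ₗ[ℝ] ℝ) (hL : ∀ q, 0 ≤ L (q * q)) (p q : ℝ[X]) :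
    L (p * q) ^ 2 ≤ L (p * p) * L (q * q) := by
  have h : ∀ t : ℝ, 0 ≤ L (q * q) * (t * t) + 2 * L (p * q) * t + L (p * p) := by
    intro t
    have h1 := hL (p + t • q)
    have h2 : (p + t • q) * (p + t • q) = p * p + (2 * t) • (p * q) + (t * t) • (q * q) := by
      simp only [smul_eq_C_mul, map_mul, map_ofNat]; ring
    rw [h2] at h1
    simp only [map_add, map_smul, smul_eq_mul] at h1
    linarith
  have := discrim_le_zero h
  unfold discrim at this
  nlinarith

/-- A functional that is nonnegative on squares and has moments growing like `M ^ n` is bounded by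
`M` in the sense of multiplication by `X`. -/
lemma abs_apply_X_mul_le (L : ℝ[X] →ₗ[ℝ] ℝ) (hL : ∀ q, 0 ≤ L (q * q)) {M : ℝ} (hM : 0 < M)
    (hb : ∀ q, ∃ c, ∀ n, |L (X ^ n * q)| ≤ c * M ^ n) (q : ℝ[X]) :
    |L (X * (q * q))| ≤ M * L (q * q) := by
  have hcs : ∀ n : ℕ, L (X ^ n * (q * q)) ^ 2 ≤ L (q * q) * L (X ^ (2 * n) * (q * q)) := by
    intro n
    have := sq_apply_mul_le L hL q (X ^ n * q)
    have e1 : q * (X ^ n * q) = X ^ n * (q * q) := by ring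
    have e2 : X ^ n * q * (X ^ n * q) = X ^ (2 * n) * (q * q) := by ring
    rwa [e1, e2] at this
  rcases (hL q).eq_or_lt with h0 | h0
  -- If `L (q * q) = 0`, Cauchy–Schwarz with `n = 1` already forces `L (X * (q * q)) = 0`.
  · have := hcs 1
    rw [← h0, zero_mul, pow_one] at this
    rw [← h0, pow_eq_zero_iff two_ne_zero |>.1 (le_antisymm this (sq_nonneg _))]
    simp
  · obtain ⟨c, hc⟩ := hb (q * q)
    set b := L (q * q)
    -- Normalised moments satisfy `r n ^ 2 ≤ |r (2 n)|`. Iterated doubling gives `|r 1| ^ (2 ^ k) ≤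
    -- |r (2 ^ k)| ≤ (c / b) * M ^ (2 ^ k)`, which is impossible for large `k` if `|r 1| > M`.
    set r : ℕ → ℝ := fun n => L (X ^ n * (q * q)) / b with hr
    have hr2 : ∀ n, r n ^ 2 ≤ |r (2 * n)| := by
      intro n
      refine le_trans ?_ (le_abs_self _)
      simp only [hr]
      rw [div_pow, div_le_div_iff₀ (by positivity) h0]
      nlinarith [hcs n]
    have hpow : ∀ k : ℕ, |r 1| ^ (2 ^ k) ≤ |r (2 ^ k)| := by
      intro k
      induction k with
      | zero => simp
      | succ k ih =>
        calc |r 1| ^ (2 ^ (k + 1)) = (|r 1| ^ (2 ^ k)) ^ 2 := by rw [pow_succ 2 k, pow_mul]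
          _ ≤ |r (2 ^ k)| ^ 2 := by gcongr
          _ = r (2 ^ k) ^ 2 := sq_abs _
          _ ≤ |r (2 ^ (k + 1))| := by rw [pow_succ' 2 k]; exact hr2 (2 ^ k)
    have hr1 : |r 1| ≤ M := by
      by_contra! hlt
      have h1 : 1 < |r 1| / M := by rwa [one_lt_div hM]
      obtain ⟨n, hn⟩ := pow_unbounded_of_one_lt (c / b) h1
      have h3 : (|r 1| / M) ^ n ≤ (|r 1| / M) ^ (2 ^ n) :=
        pow_le_pow_right₀ h1.le Nat.lt_two_pow_self.le
      have h4 : (|r 1| / M) ^ (2 ^ n) ≤ c / b := by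
        rw [div_pow, div_le_iff₀ (by positivity)]
        refine (hpow n).trans ?_
        simp only [hr]
        rw [abs_div, abs_of_pos h0, div_mul_eq_mul_div]
        gcongr
        exact hc _
      linarith
    simp only [hr, pow_one, abs_div, abs_of_pos h0] at hr1
    rwa [div_le_iff₀ h0] at hr1

/-- The factors are absorbed into `L` one at a time: by `abs_apply_X_mul_le`, `p ↦ L ((M ± X) p)` is
again nonnegative on squares, and it inherits the growth bound. -/
lemma apply_sub_pow_mul_add_pow_nonneg (L : ℝ[X] →ₗ[ℝ] ℝ) (hL : ∀ q, 0 ≤ L (q * q)) {M : ℝ}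
    (hM : 0 < M) (hb : ∀ q, ∃ c, ∀ n, |L (X ^ n * q)| ≤ c * M ^ n) (i j : ℕ) :
    0 ≤ L ((C M - X) ^ i * (C M + X) ^ j) := by
  suffices h : ∀ q, 0 ≤ L ((C M - X) ^ i * (C M + X) ^ j * (q * q)) by simpa using h 1
  induction i generalizing L with
  | zero =>
    induction j generalizing L with
    | zero => simpa using hL
    | succ j ih =>
      intro q
      have := ih (L ∘ₗ LinearMap.mulLeft ℝ (C M + X)) (fun q => ?_) (fun q => ?_) q
      · simp only [LinearMap.comp_apply, LinearMap.mulLeft_apply] at this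
        convert this using 2
        ring
      · have := abs_le.1 (abs_apply_X_mul_le L hL hM hb q)
        simp only [LinearMap.comp_apply, LinearMap.mulLeft_apply, add_mul, map_add,
          ← smul_eq_C_mul, map_smul, smul_eq_mul]
        linarith
      · obtain ⟨c, hc⟩ := hb ((C M + X) * q)
        refine ⟨c, fun n => ?_⟩
        simp only [LinearMap.comp_apply, LinearMap.mulLeft_apply]
        rw [mul_left_comm]
        exact hc n
  | succ i ih =>
    intro q
    have := ih (L ∘ₗ LinearMap.mulLeft ℝ (C M - X)) (fun q => ?_) (fun q => ?_) q
    · simp only [LinearMap.comp_apply, LinearMap.mulLeft_apply] at this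
      convert this using 2
      ring
    · have := abs_le.1 (abs_apply_X_mul_le L hL hM hb q)
      simp only [LinearMap.comp_apply, LinearMap.mulLeft_apply, sub_mul, map_sub,
        ← smul_eq_C_mul, map_smul, smul_eq_mul]
      linarith
    · obtain ⟨c, hc⟩ := hb ((C M - X) * q)
      refine ⟨c, fun n => ?_⟩
      simp only [LinearMap.comp_apply, LinearMap.mulLeft_apply]
      rw [mul_left_comm]
      exact hc n

/-- Follows from `C(n,k) C(k,i) = C(n,i) C(n-i,k-i)` and the binomial expansion of `(X + (1 - X)) ^
(n - i)`. It writes `X ^ i` exactly in the Bernstein basis. -/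
lemma sum_choose_smul_bernstein (n i : ℕ) :
    ∑ k ∈ Finset.range (n + 1), (k.choose i : ℝ) • bernsteinPolynomial ℝ n k =
      (n.choose i : ℝ) • X ^ i := by
  rcases lt_or_ge n i with hni | hni
  · rw [Nat.choose_eq_zero_of_lt hni, Finset.sum_eq_zero]
    · simp
    · intro k hk
      rw [Nat.choose_eq_zero_of_lt (by have := Finset.mem_range.1 hk; omega)]
      simp
  · obtain ⟨d, rfl⟩ := Nat.exists_eq_add_of_le hni
    rw [add_assoc, Finset.sum_range_add, Finset.sum_eq_zero, zero_add]
    · have h1 : (X + (1 - X) : ℝ[X]) ^ d = 1 := by simp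
      rw [← mul_one (X ^ i), ← h1, add_pow, Finset.mul_sum, Finset.smul_sum]
      refine Finset.sum_congr rfl fun l hl => ?_
      have h2 := Nat.choose_mul (n := i + d) (k := i + l) (s := i) (by omega)
      rw [Nat.add_sub_cancel_left, Nat.add_sub_cancel_left] at h2
      have h3 : (((i + d).choose (i + l) : ℕ) : ℝ[X]) * ((i + l).choose i : ℕ) =
          ((i + d).choose i : ℕ) * (d.choose l : ℕ) := by exact_mod_cast h2
      rw [bernsteinPolynomial, smul_eq_C_mul, smul_eq_C_mul, C_eq_natCast, C_eq_natCast,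
        Nat.add_sub_add_left, pow_add]
      linear_combination (X ^ i * X ^ l * (1 - X) ^ (d - l)) * h3
    · intro k hk
      rw [Nat.choose_eq_zero_of_lt (Finset.mem_range.1 hk)]
      simp

/-- The ratio of binomials is the product over `j < i` of `(k - j) / (n - j)`. Each factor lies in
`[0, 1]` and within `i / (n - i)` of `k / n`, so the errors add up to at most `i` times that. -/
lemma abs_choose_div_choose_sub_pow_le {n i k : ℕ} (hk : k ≤ n) (hn : i < n) :
    |(k.choose i : ℝ) / n.choose i - ((k : ℝ) / n) ^ i| ≤ i * (i / (n - i)) := by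
  have hin : (0 : ℝ) < n - i := sub_pos.2 (by exact_mod_cast hn)
  have hn0 : (0 : ℝ) < n := by exact_mod_cast (Nat.zero_le i).trans_lt hn
  have hkn : (k : ℝ) ≤ n := by exact_mod_cast hk
  have hx1 : (k : ℝ) / n ≤ 1 := (div_le_one hn0).2 hkn
  have hx0 : 0 ≤ (k : ℝ) / n := by positivity
  suffices h : ∀ j ≤ i, |(k.choose j : ℝ) / n.choose j - ((k : ℝ) / n) ^ j| ≤ j * (i / (n - i)) from
    h i le_rfl
  intro j
  induction j with
  | zero => simp
  | succ j ih =>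
    intro hj
    have hji : (j : ℝ) + 1 ≤ i := by exact_mod_cast hj
    have hjn : (0 : ℝ) < n - j := by linarith
    have e1 : ((k.choose (j + 1) : ℕ) : ℝ) * (j + 1) = k.choose j * (k - j : ℕ) := by
      exact_mod_cast Nat.choose_succ_right_eq k j
    have e2 : ((n.choose (j + 1) : ℕ) : ℝ) * (j + 1) = n.choose j * (n - j : ℕ) := by
      exact_mod_cast Nat.choose_succ_right_eq n j
    have hc1 : (0 : ℝ) < n.choose (j + 1) := by exact_mod_cast Nat.choose_pos (by omega)
    have hc0 : (0 : ℝ) < n.choose j := by exact_mod_cast Nat.choose_pos (by omega)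
    rw [Nat.cast_sub (by omega)] at e2
    have e3 : (k.choose (j + 1) : ℝ) / n.choose (j + 1) =
        k.choose j / n.choose j * ((k - j : ℕ) / (n - j)) := by
      rw [div_mul_div_comm, ← e2, ← e1, mul_div_mul_right]
      positivity
    have hle : ((k - j : ℕ) : ℝ) / (n - j) ≤ 1 := by
      rw [div_le_one hjn, ← Nat.cast_sub (by omega)]
      exact_mod_cast Nat.sub_le_sub_right hk j
    have hge : 0 ≤ ((k - j : ℕ) : ℝ) / (n - j) := by positivity
    have hfac : |((k - j : ℕ) : ℝ) / (n - j) - (k : ℝ) / n| ≤ i / (n - i) := by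
      have hmono : (j : ℝ) / (n - j) ≤ i / (n - i) := by
        gcongr <;> omega
      refine le_trans ?_ hmono
      -- The subtraction `k - j` is truncated: for `k ≤ j` the factor is `0`, and the claim reduces
      -- to `k / n ≤ j / (n - j)`.
      rcases le_total j k with hjk | hjk
      · rw [Nat.cast_sub hjk, div_sub_div _ _ hjn.ne' hn0.ne', abs_le]
        constructor
        · rw [neg_le_iff_add_nonneg, div_add_div _ _ (by positivity) (by positivity)]
          apply div_nonneg _ (by positivity)
          have : 0 ≤ (n - j : ℝ) * (j * k) := by positivity
          nlinarith
        · rw [div_le_div_iff₀ (by positivity) hjn]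
          have : 0 ≤ (n - j : ℝ) * (j * (n - k) + j * n) :=
            mul_nonneg hjn.le (add_nonneg (mul_nonneg (by positivity) (by linarith)) (by positivity))
          nlinarith
      · have hkj : (k : ℝ) ≤ j := by exact_mod_cast hjk
        rw [Nat.sub_eq_zero_of_le hjk, Nat.cast_zero, zero_div, zero_sub, abs_neg, abs_of_nonneg hx0]
        gcongr
        linarith [(Nat.cast_nonneg j : (0 : ℝ) ≤ j)]
    have hstep : (k.choose j : ℝ) / n.choose j * ((k - j : ℕ) / (n - j)) - ((k : ℝ) / n) ^ (j + 1) =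
        ((k.choose j : ℝ) / n.choose j - ((k : ℝ) / n) ^ j) * ((k - j : ℕ) / (n - j)) +
          ((k : ℝ) / n) ^ j * (((k - j : ℕ) : ℝ) / (n - j) - (k : ℝ) / n) := by ring
    rw [e3, hstep]
    refine (abs_add_le _ _).trans ?_
    rw [abs_mul, abs_mul, abs_of_nonneg hge, abs_of_nonneg (pow_nonneg hx0 j)]
    have := mul_le_of_le_one_right (abs_nonneg ((k.choose j : ℝ) / n.choose j - ((k : ℝ) / n) ^ j)) hle
    have := mul_le_of_le_one_left (abs_nonneg (((k - j : ℕ) : ℝ) / (n - j) - (k : ℝ) / n))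
      (pow_le_one₀ hx0 hx1 (n := j))
    have := ih (by omega)
    push_cast
    linarith

/-- **Hausdorff moment theorem**, for functionals on polynomials. -/
theorem exists_measure_unitInterval (L : ℝ[X] →ₗ[ℝ] ℝ)
    (hL : ∀ n k : ℕ, 0 ≤ L (X ^ k * (1 - X) ^ n)) :
    ∃ ν : FiniteMeasure unitInterval, ∀ p : ℝ[X], L p = ∫ x, p.eval (x : ℝ) ∂(ν : Measure unitInterval) := by
  have hw : ∀ n k, 0 ≤ L (bernsteinPolynomial ℝ n k) := by
    intro n k
    rw [bernsteinPolynomial, mul_assoc, ← C_eq_natCast, ← smul_eq_C_mul, map_smul]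
    exact smul_nonneg (by positivity) (hL _ _)
  let pt : ℕ → ℕ → unitInterval := fun n k => Set.projIcc 0 1 zero_le_one ((k : ℝ) / n)
  let w : ℕ → ℕ → ℝ≥0 := fun n k => (L (bernsteinPolynomial ℝ n k)).toNNReal
  -- Discrete approximations: mass `L (bernsteinPolynomial ℝ n k)` at the node `k / n`. The total
  -- mass is always `L 1`, and the moments converge to those of `L`.
  let m : ℕ → Measure unitInterval := fun n =>
    ∑ k ∈ Finset.range (n + 1), w n k • Measure.dirac (pt n k)
  have hm : ∀ n, IsFiniteMeasure (m n) := fun n => inferInstance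
  let ν : ℕ → FiniteMeasure unitInterval := fun n => ⟨m n, hm n⟩
  have hint : ∀ n (f : C(unitInterval, ℝ)), ∫ x, f x ∂(m n) =
      ∑ k ∈ Finset.range (n + 1), L (bernsteinPolynomial ℝ n k) * f (pt n k) := by
    intro n f
    rw [integral_finsetSum_measure]
    · refine Finset.sum_congr rfl fun k _ => ?_
      rw [integral_smul_nnreal_measure, integral_dirac]
      rw [NNReal.smul_def, Real.coe_toNNReal _ (hw n k), smul_eq_mul]
    · intro k _
      exact f.continuous.integrable_of_hasCompactSupport (HasCompactSupport.of_compactSpace _)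
  have hsum : ∀ n, ∑ k ∈ Finset.range (n + 1), L (bernsteinPolynomial ℝ n k) = L 1 := fun n => by
    rw [← map_sum, bernsteinPolynomial.sum]
  have hmom : ∀ i : ℕ, Tendsto (fun n => ∫ x, (x : ℝ) ^ i ∂(m n)) atTop (nhds (L (X ^ i))) := by
    intro i
    have hbound : ∀ᶠ n : ℕ in atTop,
        |∫ x, (x : ℝ) ^ i ∂(m n) - L (X ^ i)| ≤ i * (i / ((n : ℝ) - i)) * L 1 := by
      filter_upwards [eventually_gt_atTop i] with n hn
      have hc0 : (0 : ℝ) < n.choose i := by exact_mod_cast Nat.choose_pos hn.le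
      have e1 : L (X ^ i) = ∑ k ∈ Finset.range (n + 1),
          L (bernsteinPolynomial ℝ n k) * ((k.choose i : ℝ) / n.choose i) := by
        have := congrArg L (sum_choose_smul_bernstein n i)
        simp only [map_sum, map_smul, smul_eq_mul] at this
        rw [← mul_right_inj' hc0.ne', ← this, Finset.mul_sum]
        refine Finset.sum_congr rfl fun k _ => ?_
        field_simp
      have e2 := hint n ⟨fun x : unitInterval => (x : ℝ) ^ i, by fun_prop⟩
      simp only [ContinuousMap.coe_mk] at e2
      rw [e1, e2, ← Finset.sum_sub_distrib, ← hsum n, Finset.mul_sum]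
      refine (Finset.abs_sum_le_sum_abs _ _).trans (Finset.sum_le_sum fun k hk => ?_)
      have hkn : k ≤ n := Nat.lt_succ_iff.1 (Finset.mem_range.1 hk)
      have hpt : (pt n k : ℝ) = (k : ℝ) / n := by
        simp only [pt]
        rw [Set.projIcc_of_mem]
        exact ⟨by positivity, div_le_one_of_le₀ (by exact_mod_cast hkn) (by positivity)⟩
      rw [hpt, ← mul_sub, abs_mul, abs_of_nonneg (hw n k), mul_comm, abs_sub_comm]
      exact mul_le_mul_of_nonneg_right (abs_choose_div_choose_sub_pow_le hkn hn) (hw n k)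
    have hz : Tendsto (fun n : ℕ => (i : ℝ) * (i / ((n : ℝ) - i)) * L 1) atTop (nhds 0) := by
      have h1 : Tendsto (fun n : ℕ => (i : ℝ) / ((n : ℝ) - i)) atTop (nhds 0) :=
        tendsto_const_nhds.div_atTop
          (tendsto_atTop_add_const_right _ (-(i : ℝ)) tendsto_natCast_atTop_atTop)
      simpa using (h1.const_mul (i : ℝ)).mul_const (L 1)
    exact tendsto_iff_norm_sub_tendsto_zero.2
      (squeeze_zero' (Eventually.of_forall fun _ => norm_nonneg _) hbound hz)
  have hK := isCompact_setOfPred_finiteMeasure_le_of_compactSpace (E := unitInterval)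
    (L 1).toNNReal
  have hmass : ∀ n, (ν n).mass ≤ (L 1).toNNReal := by
    intro n
    rw [← NNReal.coe_le_coe, Real.coe_toNNReal _ (by simpa using hL 0 0)]
    change (m n).real Set.univ ≤ L 1
    have := hint n 1
    simp only [ContinuousMap.one_apply, integral_const, smul_eq_mul, mul_one] at this
    rw [this, hsum n]
  -- A limit along a nonprincipal ultrafilter takes the place of a convergent subsequence.
  obtain ⟨ν₀, -, hν₀⟩ := hK.ultrafilter_le_nhds ((hyperfilter ℕ : Ultrafilter ℕ).map ν)
    (by
      rw [Ultrafilter.coe_map, le_principal_iff, mem_map]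
      exact univ_mem' hmass)
  have hlim : Tendsto ν (hyperfilter ℕ) (nhds ν₀) := hν₀
  rw [FiniteMeasure.tendsto_iff_forall_integral_tendsto] at hlim
  refine ⟨ν₀, fun p => ?_⟩
  have hX : ∀ i : ℕ, L (X ^ i) = ∫ x : unitInterval, (x : ℝ) ^ i ∂(ν₀ : Measure _) := by
    intro i
    refine tendsto_nhds_unique ((hmom i).mono_left Nat.hyperfilter_le_atTop) ?_
    exact hlim (BoundedContinuousFunction.mkOfCompact ⟨fun x : unitInterval => (x : ℝ) ^ i, by fun_prop⟩)
  have hI : ∀ f : C(unitInterval, ℝ), Integrable f (ν₀ : Measure _) := fun f =>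
    f.continuous.integrable_of_hasCompactSupport (HasCompactSupport.of_compactSpace _)
  induction p using Polynomial.induction_on' with
  | add p q hp hq =>
    simp only [map_add, eval_add]
    rw [integral_add, hp, hq]
    · exact hI ⟨fun x => p.eval (x : ℝ), by fun_prop⟩
    · exact hI ⟨fun x => q.eval (x : ℝ), by fun_prop⟩
  | monomial n a =>
    rw [← C_mul_X_pow_eq_monomial, ← smul_eq_C_mul, map_smul, hX]
    simp only [eval_smul, eval_pow, eval_X, smul_eq_mul]
    rw [integral_const_mul]

/-- **Hamburger moment theorem** for a sequence of at most exponential growth: the representing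
measure lives on a compact interval. -/
theorem exists_measure_unitInterval_of_nonneg_on_squares (L : ℝ[X] →ₗ[ℝ] ℝ)
    (hL : ∀ q, 0 ≤ L (q * q)) {M c : ℝ} (hM : 0 < M) (hb : ∀ n, |L (X ^ n)| ≤ c * M ^ n) :
    ∃ ν : FiniteMeasure unitInterval, ∀ p : ℝ[X],
      L p = ∫ x, p.eval (2 * M * (x : ℝ) - M) ∂(ν : Measure unitInterval) := by
  have hb' : ∀ q, ∃ c, ∀ n, |L (X ^ n * q)| ≤ c * M ^ n := by
    intro q
    induction q using Polynomial.induction_on' with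
    | add p q hp hq =>
      obtain ⟨c₁, h₁⟩ := hp
      obtain ⟨c₂, h₂⟩ := hq
      refine ⟨c₁ + c₂, fun n => ?_⟩
      rw [mul_add, map_add, add_mul]
      exact (abs_add_le _ _).trans (add_le_add (h₁ n) (h₂ n))
    | monomial k a =>
      refine ⟨|a| * (c * M ^ k), fun n => ?_⟩
      rw [← C_mul_X_pow_eq_monomial, mul_left_comm, ← pow_add, ← smul_eq_C_mul, map_smul,
        smul_eq_mul, abs_mul, mul_assoc]
      gcongr
      refine (hb _).trans_eq ?_
      ring
  -- `r` maps `[-M, M]` affinely onto `[0, 1]`, and `s` is its inverse.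
  let r : ℝ[X] := C (2 * M)⁻¹ * (X + C M)
  let s : ℝ[X] := C (2 * M) * X - C M
  have hrs : s.comp r = X := by
    simp only [r, s, sub_comp, mul_comp, C_comp, X_comp]
    rw [← mul_assoc, ← C_mul, mul_inv_cancel₀ (by positivity)]
    simp
  let L₁ : ℝ[X] →ₗ[ℝ] ℝ := L ∘ₗ (aeval r).toLinearMap
  have hL₁ : ∀ p : ℝ[X], L₁ p = L (p.comp r) := fun _ => rfl
  have hpos : ∀ n k : ℕ, 0 ≤ L₁ (X ^ k * (1 - X) ^ n) := by
    intro n k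
    rw [hL₁]
    have e1 : (X ^ k * (1 - X) ^ n : ℝ[X]).comp r =
        C ((2 * M)⁻¹ ^ k * (2 * M)⁻¹ ^ n) * ((C M - X) ^ n * (C M + X) ^ k) := by
      have h1 : 1 - r = C (2 * M)⁻¹ * (C M - X) := by
        have h2 : (1 : ℝ[X]) = C (2 * M)⁻¹ * (C M + C M) := by
          rw [← C_add, ← C_mul, ← two_mul, inv_mul_cancel₀ (by positivity), C_1]
        rw [h2]
        ring
      simp only [mul_comp, pow_comp, sub_comp, X_comp, one_comp, h1]
      simp only [r, mul_pow, C_mul, C_pow]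
      ring
    rw [e1, ← smul_eq_C_mul, map_smul]
    exact smul_nonneg (by positivity) (apply_sub_pow_mul_add_pow_nonneg L hL hM hb' n k)
  obtain ⟨ν, hν⟩ := exists_measure_unitInterval L₁ hpos
  refine ⟨ν, fun p => ?_⟩
  have := hν (p.comp s)
  have e : L₁ (p.comp s) = L p := by
    rw [hL₁, comp_assoc, hrs, comp_X]
  rw [← e, this]
  simp [eval_comp, s]

end MomentFunctional

/-! ### Growth of `ψ` and of its Taylor coefficients -/

section EntireClass

lemma MemEntireClass.exists_hasSum {ψ : ℝ → ℝ} (h : MemEntireClass ψ) :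
    ∃ α : ℕ → ℝ, (∀ n, 0 ≤ α n) ∧ ∀ x : ℝ, HasSum (fun n => α n * x ^ n) (ψ x) := by
  obtain ⟨Φ, ⟨k, -, α, h0, hz, hk, hp, hs⟩, hΦ⟩ := h
  refine ⟨α, fun n => ?_, fun x => ?_⟩
  · rcases Nat.eq_zero_or_pos n with rfl | hn
    · exact h0
    · rcases lt_trichotomy n k with h | rfl | h
      · exact (hz n hn h).ge
      · exact hk.le
      · exact hp n h
  · have := hs x
    rw [hΦ] at this
    exact_mod_cast this

variable {ψ : ℝ → ℝ} {α : ℕ → ℝ}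

lemma monotoneOn_of_hasSum (hα : ∀ n, 0 ≤ α n)
    (hs : ∀ x : ℝ, HasSum (fun n => α n * x ^ n) (ψ x)) {x y : ℝ} (hx : 0 ≤ x) (hxy : x ≤ y) :
    ψ x ≤ ψ y :=
  hasSum_le (fun n => mul_le_mul_of_nonneg_left (pow_le_pow_left₀ hx hxy n) (hα n)) (hs x) (hs y)

lemma differentiable_of_hasSum (hs : ∀ x : ℝ, HasSum (fun n => α n * x ^ n) (ψ x)) :
    Differentiable ℝ ψ := by
  have hrad : (FormalMultilinearSeries.ofScalars ℝ α).radius = ⊤ := by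
    refine FormalMultilinearSeries.radius_eq_top_of_summable_norm _ fun r => ?_
    refine Summable.of_nonneg_of_le (fun n => by positivity) (fun n => ?_) (hs r).summable.norm
    rw [norm_mul, norm_pow, Real.norm_of_nonneg r.coe_nonneg, FormalMultilinearSeries.ofScalars_norm]
  have hfps : HasFPowerSeriesOnBall ψ (FormalMultilinearSeries.ofScalars ℝ α) 0 ⊤ := by
    refine ⟨hrad.ge, by simp, fun {y} _ => ?_⟩
    simp only [zero_add, FormalMultilinearSeries.ofScalars_apply_eq, smul_eq_mul]
    exact hs y
  intro x
  exact (hfps.analyticAt_of_mem (by simp)).differentiableAt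

/-- For real `M` above the limsup, `exp (-M x) * ψ x` has nonpositive derivative far out. -/
lemma exists_shift_le_exp_mul (hψ_pos : ∀ x : ℝ, 0 < ψ x) (hd : Differentiable ℝ ψ)
    (hψ_limsup : limsup (fun x : ℝ => ((deriv ψ x / ψ x : ℝ) : EReal)) atTop < ⊤) :
    ∃ M x₀ : ℝ, 0 ≤ x₀ ∧ ∀ x ≥ x₀, ∀ c ≥ 0, ψ (x + c) ≤ Real.exp (M * c) * ψ x := by
  obtain ⟨M, hM, -⟩ := EReal.lt_iff_exists_real_btwn.1 hψ_limsup
  obtain ⟨x₁, hx₁⟩ := eventually_atTop.1 (eventually_lt_of_limsup_lt hM)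
  refine ⟨M, max x₁ 0, le_max_right _ _, fun x hx c hc => ?_⟩
  have hanti : AntitoneOn (fun x => Real.exp (-(M * x)) * ψ x) (Set.Ici x₁) := by
    refine antitoneOn_of_deriv_nonpos (convex_Ici _)
      (Continuous.continuousOn (by have := hd.continuous; fun_prop))
      (Differentiable.differentiableOn (by fun_prop)) fun y hy => ?_
    rw [interior_Ici] at hy
    have h1 : deriv ψ y / ψ y < M := by exact_mod_cast hx₁ y (le_of_lt hy)
    rw [div_lt_iff₀ (hψ_pos y)] at h1
    have h2 : HasDerivAt (fun x => Real.exp (-(M * x))) (Real.exp (-(M * y)) * (-(M * 1))) y :=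
      (((hasDerivAt_id y).const_mul M).neg).exp
    rw [(h2.fun_mul (hd y).hasDerivAt).deriv]
    have := Real.exp_pos (-(M * y))
    nlinarith
  have hx1 : x₁ ≤ x := (le_max_left _ _).trans hx
  have h := hanti (Set.mem_Ici.2 hx1) (Set.mem_Ici.2 (by linarith : x₁ ≤ x + c)) (by linarith)
  simp only [] at h
  have e : Real.exp (M * c) * ψ x =
      Real.exp (M * (x + c)) * (Real.exp (-(M * x)) * ψ x) := by
    rw [← mul_assoc, ← Real.exp_add]
    ring_nf
  have e' : ψ (x + c) = Real.exp (M * (x + c)) * (Real.exp (-(M * (x + c))) * ψ (x + c)) := by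
    rw [← mul_assoc, ← Real.exp_add]
    simp
  rw [e, e']
  gcongr

lemma exists_shift_le_mul (hψ_pos : ∀ x : ℝ, 0 < ψ x)
    (hmono : ∀ x y : ℝ, 0 ≤ x → x ≤ y → ψ x ≤ ψ y) (hd : Differentiable ℝ ψ)
    (hψ_limsup : limsup (fun x : ℝ => ((deriv ψ x / ψ x : ℝ) : EReal)) atTop < ⊤)
    {c : ℝ} (hc : 0 ≤ c) : ∃ K > 0, ∀ x ≥ 0, ψ (x + c) ≤ K * ψ x := by
  obtain ⟨M, x₀, hx₀, h⟩ := exists_shift_le_exp_mul hψ_pos hd hψ_limsup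
  have p0 := hψ_pos 0
  have px := hψ_pos x₀
  -- The factor `ψ x₀ / ψ 0 ≥ 1` pays for `x < x₀`, where `ψ (x + c) ≤ ψ (x₀ + c)` and `ψ 0 ≤ ψ x`.
  refine ⟨Real.exp (M * c) * (ψ x₀ / ψ 0), by positivity, fun x hx => ?_⟩
  rcases le_total x₀ x with hxx | hxx
  · refine (h x hxx c hc).trans ?_
    have := hψ_pos x
    gcongr
    refine le_mul_of_one_le_right (by positivity) ?_
    rw [one_le_div p0]
    exact hmono 0 x₀ le_rfl hx₀
  · calc ψ (x + c) ≤ ψ (x₀ + c) := hmono _ _ (by positivity) (by linarith)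
      _ ≤ Real.exp (M * c) * ψ x₀ := h x₀ le_rfl c hc
      _ = Real.exp (M * c) * (ψ x₀ / ψ 0) * ψ 0 := by field_simp
      _ ≤ _ := by
        gcongr
        exact hmono 0 x le_rfl hx

/-- Evaluating at `x = n` gives `n! * α n ≤ n ^ n * α n ≤ ψ n`, a single term against the whole
series, and `ψ` grows at most exponentially. -/
lemma exists_factorial_mul_le (hψ_pos : ∀ x : ℝ, 0 < ψ x) (hα : ∀ n, 0 ≤ α n)
    (hs : ∀ x : ℝ, HasSum (fun n => α n * x ^ n) (ψ x))
    (hψ_limsup : limsup (fun x : ℝ => ((deriv ψ x / ψ x : ℝ) : EReal)) atTop < ⊤) :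
    ∃ c R : ℝ, 0 < R ∧ ∀ n : ℕ, (n.factorial : ℝ) * α n ≤ c * R ^ n := by
  obtain ⟨M, x₀, hx₀, h⟩ :=
    exists_shift_le_exp_mul hψ_pos (differentiable_of_hasSum hs) hψ_limsup
  refine ⟨ψ x₀, Real.exp M, Real.exp_pos _, fun n => ?_⟩
  calc (n.factorial : ℝ) * α n ≤ (n : ℝ) ^ n * α n := by
        gcongr
        · exact hα n
        · exact_mod_cast Nat.factorial_le_pow n
    _ = α n * (n : ℝ) ^ n := mul_comm _ _
    _ ≤ ψ n := le_hasSum (hs n) n fun j _ => mul_nonneg (hα j) (by positivity)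
    _ ≤ ψ (x₀ + n) := monotoneOn_of_hasSum hα hs (by positivity) (by linarith)
    _ ≤ Real.exp (M * n) * ψ x₀ := h x₀ le_rfl n (by positivity)
    _ = _ := by rw [mul_comm M, Real.exp_nat_mul, mul_comm]

end EntireClass

/-! ### From samples of `ψ` to its derivatives at `0` -/

section Limit
open Polynomial

/-- The linear functional on polynomials sending `X ^ n` to `m n`. -/
noncomputable def momentFunctional (m : ℕ → ℝ) : ℝ[X] →ₗ[ℝ] ℝ :=
  Polynomial.lsum fun n => LinearMap.toSpanSingleton ℝ ℝ (m n)

lemma momentFunctional_monomial (m : ℕ → ℝ) (n : ℕ) (a : ℝ) :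
    momentFunctional m (monomial n a) = a * m n := by
  simp [momentFunctional, Polynomial.lsum_apply]

lemma momentFunctional_X_pow (m : ℕ → ℝ) (n : ℕ) : momentFunctional m (X ^ n) = m n := by
  rw [X_pow_eq_monomial, momentFunctional_monomial, one_mul]

/-- The right-hand side is the `n`-th forward difference of `m` at `0`. -/
lemma momentFunctional_X_sub_one_pow (m : ℕ → ℝ) (n : ℕ) :
    momentFunctional m ((X - 1) ^ n) = ∑ k ∈ Finset.range (n + 1), (-1) ^ (n - k) * n.choose k * m k := by
  have h : ((X : ℝ[X]) - 1) ^ n =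
      ∑ k ∈ Finset.range (n + 1), monomial k ((-1) ^ (n - k) * n.choose k : ℝ) := by
    rw [sub_eq_add_neg, add_pow]
    refine Finset.sum_congr rfl fun k _ => ?_
    rw [← C_mul_X_pow_eq_monomial]
    simp only [map_mul, map_pow, map_neg, map_one, map_natCast]
    ring
  rw [h, map_sum]
  simp only [momentFunctional_monomial]

lemma momentFunctional_pow_X_sub_one_pow (n l : ℕ) :
    momentFunctional (fun k => (k : ℝ) ^ l) ((X - 1) ^ n) =
      (fwdDiff (1 : ℝ))^[n] (fun x => x ^ l) 0 := by
  rw [momentFunctional_X_sub_one_pow, fwdDiff_iter_eq_sum_shift]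
  simp

lemma abs_momentFunctional_pow_X_sub_one_pow_le (n l : ℕ) :
    |momentFunctional (fun k => (k : ℝ) ^ l) ((X - 1) ^ n)| ≤ 2 ^ n * (n : ℝ) ^ l := by
  rw [momentFunctional_X_sub_one_pow]
  have h2 : (2 : ℝ) ^ n = ∑ k ∈ Finset.range (n + 1), (n.choose k : ℝ) := by
    exact_mod_cast (Nat.sum_range_choose n).symm
  rw [h2, Finset.sum_mul]
  refine (Finset.abs_sum_le_sum_abs _ _).trans (Finset.sum_le_sum fun k hk => ?_)
  rw [abs_mul, abs_mul, abs_pow, abs_neg, abs_one, one_pow, one_mul, Nat.abs_cast, abs_pow,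
    Nat.abs_cast]
  gcongr
  exact Nat.lt_succ_iff.1 (Finset.mem_range.1 hk)

variable {ψ : ℝ → ℝ} {α : ℕ → ℝ}

lemma hasSum_momentFunctional (hs : ∀ x : ℝ, HasSum (fun n => α n * x ^ n) (ψ x)) (h : ℝ)
    (p : ℝ[X]) :
    HasSum (fun l => α l * h ^ l * momentFunctional (fun k => (k : ℝ) ^ l) p)
      (momentFunctional (fun k => ψ (k * h)) p) := by
  induction p using Polynomial.induction_on' with
  | add p q hp hq => simpa only [map_add, mul_add] using hp.add hq
  | monomial n a =>
    simp only [momentFunctional_monomial]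
    refine ((hs (n * h)).mul_left a).congr_fun fun l => ?_
    ring

/-- Divided forward differences of a power series at `0` converge to its Taylor coefficients. -/
lemma tendsto_momentFunctional_div_pow (hα : ∀ n, 0 ≤ α n)
    (hs : ∀ x : ℝ, HasSum (fun n => α n * x ^ n) (ψ x)) (n : ℕ) :
    Tendsto (fun h : ℝ => momentFunctional (fun k => ψ (k * h)) ((X - 1) ^ n) / h ^ n)
      (nhdsWithin 0 (Set.Ioi 0)) (nhds (n.factorial * α n)) := by
  set D : ℕ → ℝ := fun l => momentFunctional (fun k => (k : ℝ) ^ l) ((X - 1) ^ n) with hD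
  have hD0 : ∀ l < n, D l = 0 := fun l hl => by
    simp only [hD, momentFunctional_pow_X_sub_one_pow]
    rw [fwdDiff_iter_pow_eq_zero_of_lt hl]
    rfl
  have hDn : D n = n.factorial := by
    simp only [hD, momentFunctional_pow_X_sub_one_pow]
    rw [fwdDiff_iter_eq_factorial]
    rfl
  -- The terms of degree below `n` vanish, so division by `h ^ n` leaves a power series in `h`. For
  -- `0 < h < 1` it is dominated by `2 ^ n` times a tail of the series of `ψ` at `n`.
  have hlim : Tendsto (fun h : ℝ => ∑' l, α (l + n) * D (l + n) * h ^ l)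
      (nhdsWithin 0 (Set.Ioi 0)) (nhds (∑' l, if l = 0 then (n.factorial : ℝ) * α n else 0)) := by
    refine tendsto_tsum_of_dominated_convergence
      (bound := fun l => 2 ^ n * (α (l + n) * (n : ℝ) ^ (l + n))) ?_ ?_ ?_
    · exact ((summable_nat_add_iff n).2 (hs n).summable).mul_left _
    · intro l
      refine Tendsto.mono_left ?_ nhdsWithin_le_nhds
      have : Tendsto (fun h : ℝ => α (l + n) * D (l + n) * h ^ l) (nhds 0)
          (nhds (α (l + n) * D (l + n) * 0 ^ l)) := Continuous.tendsto (by fun_prop) 0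
      convert this using 2
      rcases Nat.eq_zero_or_pos l with rfl | hl
      · simp [hDn, mul_comm]
      · simp [hl.ne']
    · filter_upwards [Ioo_mem_nhdsGT (zero_lt_one' ℝ)] with h hh l
      rw [norm_mul, norm_mul, norm_pow, Real.norm_of_nonneg (hα _), Real.norm_of_nonneg hh.1.le]
      calc α (l + n) * ‖D (l + n)‖ * h ^ l ≤ α (l + n) * (2 ^ n * (n : ℝ) ^ (l + n)) * 1 := by
            have := hα (l + n)
            have := pow_nonneg hh.1.le l
            gcongr
            · exact abs_momentFunctional_pow_X_sub_one_pow_le n (l + n)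
            · exact pow_le_one₀ hh.1.le hh.2.le
        _ = _ := by ring
  rw [tsum_ite_eq] at hlim
  refine hlim.congr' ?_
  filter_upwards [self_mem_nhdsWithin] with h hh
  have hh : 0 < h := hh
  have h1 := hasSum_momentFunctional hs h ((X - 1) ^ n)
  rw [← hasSum_nat_add_iff' n, Finset.sum_eq_zero, sub_zero] at h1
  · rw [← (h1.div_const (h ^ n)).tsum_eq]
    refine tsum_congr fun l => ?_
    rw [pow_add]
    field_simp
    rfl
  · intro l hl
    have := hD0 l (Finset.mem_range.1 hl)
    simp only [hD] at this
    rw [this, mul_zero]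

/-- If the sequences `n ↦ ψ (n h)` are positive definite for arbitrarily small `h > 0`, then so is
the sequence of derivatives of `ψ` at `0`. -/
lemma momentFunctional_factorial_mul_nonneg (hα : ∀ n, 0 ≤ α n)
    (hs : ∀ x : ℝ, HasSum (fun n => α n * x ^ n) (ψ x))
    (hpos : ∃ᶠ h in nhdsWithin (0 : ℝ) (Set.Ioi 0),
      ∀ q : ℝ[X], 0 ≤ momentFunctional (fun k => ψ (k * h)) (q * q)) (q : ℝ[X]) :
    0 ≤ momentFunctional (fun n => n.factorial * α n) (q * q) := by
  -- Composition with `(X - 1) / h` is multiplicative, hence sends squares to squares; a negative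
  -- limit would then contradict positivity at some small `h`.
  have hlim : ∀ p : ℝ[X], Tendsto
      (fun h : ℝ => momentFunctional (fun k => ψ (k * h)) (p.comp (C h⁻¹ * (X - 1))))
      (nhdsWithin 0 (Set.Ioi 0)) (nhds (momentFunctional (fun n => n.factorial * α n) p)) := by
    intro p
    induction p using Polynomial.induction_on' with
    | add p q hp hq => simpa only [map_add, add_comp] using hp.add hq
    | monomial n a =>
      rw [momentFunctional_monomial]
      refine ((tendsto_momentFunctional_div_pow hα hs n).const_mul a).congr fun h => ?_
      rw [monomial_comp, mul_pow, ← C_pow, ← smul_eq_C_mul, ← smul_eq_C_mul, map_smul, map_smul,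
        smul_eq_mul, smul_eq_mul, inv_pow, div_eq_inv_mul]
  by_contra! hneg
  obtain ⟨h, h1, h2⟩ := (hpos.and_eventually ((hlim (q * q)).eventually_lt_const hneg)).exists
  rw [mul_comp] at h2
  exact absurd (h1 _) (not_le.2 h2)

end Limit

/-! ### The cosh transform from the moments -/

/-- A power series with positive definite, exponentially bounded derivatives at `0` whose sum is
even is the hyperbolic cosine transform of a compactly supported measure. -/
theorem isCompactCoshTransform_of_nonneg_on_squares {ψ : ℝ → ℝ} {α : ℕ → ℝ} (hα : ∀ n, 0 ≤ α n)
    (hs : ∀ x : ℝ, HasSum (fun n => α n * x ^ n) (ψ x)) (hψ_even : ∀ x : ℝ, ψ (-x) = ψ x)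
    {c R : ℝ} (hR : 0 < R) (hb : ∀ n : ℕ, (n.factorial : ℝ) * α n ≤ c * R ^ n)
    (hpos : ∀ q, 0 ≤ momentFunctional (fun n => n.factorial * α n) (q * q)) :
    IsCompactCoshTransform ψ := by
  obtain ⟨ν, hν⟩ := exists_measure_unitInterval_of_nonneg_on_squares _ hpos hR
    (c := c) (fun n => by
      rw [momentFunctional_X_pow, abs_of_nonneg (mul_nonneg (by positivity) (hα n))]
      exact hb n)
  have hI : ∀ f : unitInterval → ℝ, Continuous f → Integrable f (ν : Measure unitInterval) :=
    fun f hf => hf.integrable_of_hasCompactSupport (HasCompactSupport.of_compactSpace _)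
  have hexp : ∀ x : ℝ,
      ψ x = ∫ u : unitInterval, Real.exp (x * (2 * R * u - R)) ∂(ν : Measure unitInterval) := by
    intro x
    have hm : ∀ n, ∫ u : unitInterval, (x * (2 * R * u - R)) ^ n / n.factorial
        ∂(ν : Measure unitInterval) = α n * x ^ n := by
      intro n
      have h1 := hν (Polynomial.X ^ n)
      rw [momentFunctional_X_pow] at h1
      simp only [Polynomial.eval_pow, Polynomial.eval_X] at h1
      simp only [mul_pow, mul_div_right_comm]
      rw [integral_const_mul, ← h1]
      field_simp
    have h2 : HasSum (fun n => ∫ u : unitInterval, (x * (2 * R * u - R)) ^ n / n.factorial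
        ∂(ν : Measure unitInterval))
        (∫ u : unitInterval, Real.exp (x * (2 * R * u - R)) ∂(ν : Measure unitInterval)) := by
      refine hasSum_integral_of_dominated_convergence
        (bound := fun n _ => (|x| * R) ^ n / n.factorial) (fun n => ?_) (fun n => ?_) ?_ ?_ ?_
      · exact Continuous.aestronglyMeasurable (by fun_prop)
      · refine Eventually.of_forall fun u => ?_
        have hu0 := u.2.1
        have hu1 := u.2.2
        have : |2 * R * (u : ℝ) - R| ≤ R := by
          rw [abs_le]
          constructor <;> nlinarith
        rw [norm_div, norm_pow, norm_mul, Real.norm_eq_abs, Real.norm_eq_abs, RCLike.norm_natCast]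
        gcongr
      · exact Eventually.of_forall fun u => Real.summable_pow_div_factorial _
      · exact integrable_const _
      · refine Eventually.of_forall fun u => ?_
        rw [Real.exp_eq_exp_ℝ]
        exact NormedSpace.expSeries_div_hasSum_exp _
    simp only [hm] at h2
    exact (hs x).unique h2
  -- The measure on `[-R, R]` is folded onto `[0, R]` by `t ↦ |t|`, which `cosh` does not see.
  let g : unitInterval → ℝ≥0 := fun u => Real.toNNReal |2 * R * u - R|
  have hg : Continuous g := continuous_real_toNNReal.comp (by fun_prop)
  have hcosh : ∀ x : ℝ, ∀ u : unitInterval,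
      Real.cosh (x * (g u : ℝ)) = Real.cosh (x * (2 * R * u - R)) := by
    intro x u
    simp only [g, Real.coe_toNNReal _ (abs_nonneg _)]
    rw [← Real.cosh_abs, abs_mul, abs_abs, ← abs_mul, Real.cosh_abs]
  refine ⟨(ν : Measure unitInterval).map g, ⟨Set.range g, isCompact_range hg, ?_⟩, fun x => ⟨?_, ?_⟩⟩
  · rw [Measure.map_apply hg.measurable (isCompact_range hg).measurableSet.compl]
    simp
  · rw [integrable_map_measure (Continuous.aestronglyMeasurable (by fun_prop)) hg.aemeasurable]
    exact hI _ (by fun_prop)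
  · rw [integral_map hg.aemeasurable (Continuous.aestronglyMeasurable (by fun_prop))]
    -- The integral of `cosh` is the mean of `ψ x` and `ψ (-x)`.
    simp only [hcosh, Real.cosh_eq]
    rw [integral_div, integral_add (hI _ (by fun_prop)) (hI _ (by fun_prop))]
    simp only [← neg_mul]
    rw [← hexp, ← hexp, hψ_even]
    ring

/-! ### Positive definiteness from subnormality -/

section Subnormal
open Polynomial ContinuousLinearMap

/-- A Hankel matrix that is a Gram matrix has a functional nonnegative on squares: with `p = q` the
right-hand side is a squared norm. -/
lemma momentFunctional_mul_eq_inner {K : Type*} [NormedAddCommGroup K] [InnerProductSpace ℝ K]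
    {m : ℕ → ℝ} {v : ℕ → K} (h : ∀ i j, m (i + j) = inner ℝ (v i) (v j)) (p q : ℝ[X]) :
    momentFunctional m (p * q) =
      inner ℝ (Polynomial.lsum (fun n => LinearMap.toSpanSingleton ℝ K (v n)) p)
        (Polynomial.lsum (fun n => LinearMap.toSpanSingleton ℝ K (v n)) q) := by
  induction p using Polynomial.induction_on' with
  | add p₁ p₂ h₁ h₂ => rw [add_mul, map_add, map_add, inner_add_left, h₁, h₂]
  | monomial i a =>
    induction q using Polynomial.induction_on' with
    | add q₁ q₂ h₁ h₂ => rw [mul_add, map_add, map_add, inner_add_right, h₁, h₂]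
    | monomial j b =>
      rw [monomial_mul_monomial, momentFunctional_monomial, h]
      simp [Polynomial.lsum_apply, real_inner_smul_left, real_inner_smul_right]
      ring

/-- For a subnormal operator `T`, the sequence `n ↦ ‖T ^ n f‖ ^ 2` is positive definite. -/
lemma IsSubnormalOp.momentFunctional_nonneg.{u} {H : Type u} [NormedAddCommGroup H]
    [InnerProductSpace ℂ H] {T : H →L[ℂ] H} (hT : IsSubnormalOp T) (f : H) (q : ℝ[X]) :
    0 ≤ momentFunctional (fun n => ‖(T ^ n) f‖ ^ 2) (q * q) := by
  obtain ⟨K, _, _, _, N, V, hN, hV⟩ := hT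
  have hpow : ∀ n : ℕ, V ((T ^ n) f) = (N ^ n) (V f) := by
    intro n
    induction n with
    | zero => simp
    | succ n ih => rw [pow_succ', pow_succ', mul_def, mul_def, comp_apply, comp_apply, hV, ih]
  set P : K →L[ℂ] K := star N * N with hP
  have hPn : ∀ n : ℕ, P ^ n = adjoint (N ^ n) * N ^ n := by
    intro n
    rw [hP, hN.star_comm_self.mul_pow, ← star_eq_adjoint, star_pow]
  have hPadj : ∀ n : ℕ, adjoint (P ^ n) = P ^ n := by
    intro n
    rw [← star_eq_adjoint, star_pow, hP, star_mul, star_star]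
  let _ : InnerProductSpace ℝ K := InnerProductSpace.rclikeToReal ℂ K
  -- With `P = N* N` self-adjoint and `N` normal, `‖N ^ (i + j) x‖ ^ 2 = ⟪P ^ (i + j) x, x⟫ = ⟪P ^ i
  -- x, P ^ j x⟫`.
  rw [momentFunctional_mul_eq_inner (K := K) (v := fun i => (P ^ i) (V f))]
  · exact real_inner_self_nonneg
  · intro i j
    rw [real_inner_eq_re_inner ℂ, ← V.norm_map, hpow, ← inner_self_eq_norm_sq (𝕜 := ℂ)]
    congr 1
    conv_rhs => rw [← hPadj i, adjoint_inner_left, ← comp_apply, ← mul_def, ← pow_add, hPn, mul_def,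
      comp_apply,
      adjoint_inner_right]

end Subnormal

/-! ### Composition operators and their adjoints on indicators -/

section Composition
open ContinuousLinearMap

lemma IsCompositionOp.pow {X : Type*} [MeasurableSpace X] {μ : Measure X} {T : X → X}
    {C : Lp ℂ 2 μ →L[ℂ] Lp ℂ 2 μ} (h : IsCompositionOp μ T C) (n : ℕ) :
    IsCompositionOp μ T^[n] (C ^ n) := by
  induction n with
  | zero =>
    intro f hf
    simpa using hf.coeFn_toLp
  | succ n ih =>
    intro f hf
    have h1 := ih f hf
    have h2 : MemLp (f ∘ T^[n]) 2 μ := (Lp.memLp _).ae_eq h1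
    have h3 : (C ^ n) (hf.toLp f) = h2.toLp _ := by
      rw [Lp.ext_iff]
      exact h1.trans h2.coeFn_toLp.symm
    rw [pow_succ', mul_def, comp_apply, h3, Function.iterate_succ, ← Function.comp_assoc]
    exact h _ h2

variable {κ : ℕ} {ψ : ℝ → ℝ}

lemma measurable_radialDensity (hψ_cont : Continuous ψ) : Measurable
    fun x : EuclideanSpace ℝ (Fin κ) => ENNReal.ofReal (ψ ‖x‖)⁻¹ :=
  ((hψ_cont.measurable.comp measurable_norm).inv).ennreal_ofReal

lemma isLocallyFiniteMeasure_radialMeasure (hψ_pos : ∀ x : ℝ, 0 < ψ x) (hψ_cont : Continuous ψ) :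
    IsLocallyFiniteMeasure (radialMeasure κ ψ) :=
  IsLocallyFiniteMeasure.withDensity_ofReal
    ((hψ_cont.comp continuous_norm).inv₀ fun _ => (hψ_pos _).ne')

lemma integral_radialMeasure (hψ_pos : ∀ x : ℝ, 0 < ψ x) (hψ_cont : Continuous ψ) {F : Type*}
    [NormedAddCommGroup F] [NormedSpace ℝ F] (g : EuclideanSpace ℝ (Fin κ) → F) :
    ∫ x, g x ∂radialMeasure κ ψ = ∫ x, (ψ ‖x‖)⁻¹ • g x := by
  rw [radialMeasure, integral_withDensity_eq_integral_toReal_smul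
    (measurable_radialDensity hψ_cont) (Eventually.of_forall fun _ => ENNReal.ofReal_lt_top)]
  refine integral_congr_ae (Eventually.of_forall fun x => ?_)
  simp only []
  rw [ENNReal.toReal_ofReal (inv_nonneg.2 (hψ_pos _).le)]

/-- Change of variables `y = θ x`. The weight multiplying `g` is the adjoint of the composition
operator applied to the indicator of `B`; it is supported on `θ.symm ⁻¹' B`, the image of `B`. -/
lemma setIntegral_comp_radialMeasure (hψ_pos : ∀ x : ℝ, 0 < ψ x) (hψ_cont : Continuous ψ)
    (θ : EuclideanSpace ℝ (Fin κ) ≃ₜ EuclideanSpace ℝ (Fin κ)) {c : ℝ} (hc : 0 < c)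
    (hθ : Measure.map θ volume = ENNReal.ofReal c • volume) {B : Set (EuclideanSpace ℝ (Fin κ))}
    (hB : MeasurableSet B) (g : EuclideanSpace ℝ (Fin κ) → ℂ) :
    ∫ x in B, g (θ x) ∂radialMeasure κ ψ = ∫ y, g y *
      (θ.symm ⁻¹' B).indicator (fun y => ((c * (ψ ‖y‖ / ψ ‖θ.symm y‖) : ℝ) : ℂ)) y
        ∂radialMeasure κ ψ := by
  rw [← integral_indicator hB, integral_radialMeasure hψ_pos hψ_cont,
    integral_radialMeasure hψ_pos hψ_cont]
  have h1 : ∀ x, (ψ ‖x‖)⁻¹ • B.indicator (fun x => g (θ x)) x =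
      (fun y => (ψ ‖θ.symm y‖)⁻¹ • (θ.symm ⁻¹' B).indicator g y) (θ x) := by
    intro x
    simp only [θ.symm_apply_apply]
    by_cases hx : x ∈ B <;> simp [Set.indicator, hx]
  simp only [h1]
  rw [← θ.measurableEmbedding.integral_map (fun y => (ψ ‖θ.symm y‖)⁻¹ • (θ.symm ⁻¹' B).indicator g y),
    hθ, integral_smul_measure, ENNReal.toReal_ofReal hc.le, ← integral_smul]
  refine integral_congr_ae (Eventually.of_forall fun y => ?_)
  by_cases hy : θ.symm y ∈ B
  · simp only [Set.indicator, Set.mem_preimage, hy, if_true, Complex.real_smul]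
    have : (ψ ‖y‖ : ℂ) ≠ 0 := by exact_mod_cast (hψ_pos _).ne'
    push_cast
    field_simp
  · simp [Set.indicator, hy]

/-- The norm of the adjoint of a composition operator at the indicator function of a compact set. -/
lemma norm_adjoint_indicator_sq (hψ_pos : ∀ x : ℝ, 0 < ψ x) (hψ_cont : Continuous ψ)
    (θ : EuclideanSpace ℝ (Fin κ) ≃ₜ EuclideanSpace ℝ (Fin κ)) {c : ℝ} (hc : 0 < c)
    (hθ : Measure.map θ volume = ENNReal.ofReal c • volume) {B : Set (EuclideanSpace ℝ (Fin κ))}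
    (hB : IsCompact B) (hμB : radialMeasure κ ψ B ≠ ∞)
    {C : Lp ℂ 2 (radialMeasure κ ψ) →L[ℂ] Lp ℂ 2 (radialMeasure κ ψ)}
    (hC : IsCompositionOp (radialMeasure κ ψ) θ C) :
    ‖adjoint C (indicatorConstLp 2 hB.measurableSet hμB 1)‖ ^ 2 =
      ∫ x in B, c * (ψ ‖θ x‖ / ψ ‖x‖) ∂radialMeasure κ ψ := by
  have := isLocallyFiniteMeasure_radialMeasure (κ := κ) hψ_pos hψ_cont
  set f : Lp ℂ 2 (radialMeasure κ ψ) := indicatorConstLp 2 hB.measurableSet hμB 1 with hf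
  have hcont : Continuous fun y => ((c * (ψ ‖y‖ / ψ ‖θ.symm y‖) : ℝ) : ℂ) := by
    refine Complex.continuous_ofReal.comp (continuous_const.mul (Continuous.div ?_ ?_ fun _ => ?_))
    · fun_prop
    · exact hψ_cont.comp θ.symm.continuous.norm
    · exact (hψ_pos _).ne'
  have hK : IsCompact (θ.symm ⁻¹' B) := θ.symm.isClosedEmbedding.isCompact_preimage hB
  set w := (θ.symm ⁻¹' B).indicator (fun y => ((c * (ψ ‖y‖ / ψ ‖θ.symm y‖) : ℝ) : ℂ)) with hw
  have hwL : MemLp w 2 (radialMeasure κ ψ) := by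
    rw [hw, memLp_indicator_iff_restrict hK.measurableSet]
    have : IsFiniteMeasure ((radialMeasure κ ψ).restrict (θ.symm ⁻¹' B)) :=
      ⟨by simpa using hK.measure_lt_top⟩
    obtain ⟨b, hb⟩ := hK.exists_bound_of_continuousOn hcont.continuousOn
    exact MemLp.of_bound hcont.aestronglyMeasurable b
      ((ae_restrict_mem hK.measurableSet).mono hb)
  have hconj : ∀ y, (starRingEnd ℂ) (w y) = w y := by
    intro y
    by_cases hy : y ∈ θ.symm ⁻¹' B
    · simp only [hw, Set.indicator_of_mem hy, Complex.conj_ofReal]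
    · simp [hw, Set.indicator_of_notMem hy]
  have hinner : ∀ g : Lp ℂ 2 (radialMeasure κ ψ), inner ℂ f (C g) = inner ℂ (hwL.toLp w) g := by
    intro g
    have h1 := hC g (Lp.memLp g)
    rw [Lp.toLp_coeFn] at h1
    rw [hf, L2.inner_indicatorConstLp_one, integral_congr_ae (ae_restrict_of_ae h1), L2.inner_def]
    simp only [Function.comp_apply]
    rw [setIntegral_comp_radialMeasure hψ_pos hψ_cont θ hc hθ hB.measurableSet]
    refine integral_congr_ae ?_
    filter_upwards [hwL.coeFn_toLp] with y hy
    rw [RCLike.inner_apply, hy, hconj]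
  have hadj : adjoint C f = hwL.toLp w := by
    refine ext_inner_right ℂ fun g => ?_
    rw [adjoint_inner_left, hinner]
  -- The squared norm of the adjoint at `f` is `⟪f, C w⟫`, the integral of `w ∘ θ` over `B`.
  have h2 : inner ℂ f (C (hwL.toLp w)) =
      ((∫ x in B, c * (ψ ‖θ x‖ / ψ ‖x‖) ∂radialMeasure κ ψ : ℝ) : ℂ) := by
    rw [hf, L2.inner_indicatorConstLp_one, integral_congr_ae (ae_restrict_of_ae (hC w hwL)),
      ← integral_complex_ofReal]
    refine setIntegral_congr_fun hB.measurableSet fun x hx => ?_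
    have : θ x ∈ θ.symm ⁻¹' B := by simpa using hx
    simp only [Function.comp_apply, hw, Set.indicator_of_mem this, θ.symm_apply_apply]
  rw [← inner_self_eq_norm_sq (𝕜 := ℂ), adjoint_inner_left, hadj, h2]
  exact RCLike.ofReal_re _

end Composition

/-! ### Affine symbols: positivity of samples and boundedness -/

section AffineSymbol
open Polynomial ContinuousLinearMap

lemma continuous_momentFunctional {X : Type*} [TopologicalSpace X] {m : ℕ → X → ℝ}
    (hm : ∀ n, Continuous (m n)) (p : ℝ[X]) :
    Continuous fun x => momentFunctional (fun n => m n x) p := by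
  induction p using Polynomial.induction_on' with
  | add p q hp hq => simpa only [map_add] using hp.fun_add hq
  | monomial n a => simpa only [momentFunctional_monomial] using (hm n).const_mul a

lemma momentFunctional_integral {X : Type*} [MeasurableSpace X] {μ : Measure X} {m : ℕ → X → ℝ}
    (hm : ∀ n, Integrable (m n) μ) (p : ℝ[X]) :
    Integrable (fun x => momentFunctional (fun n => m n x) p) μ ∧
      momentFunctional (fun n => ∫ x, m n x ∂μ) p =
        ∫ x, momentFunctional (fun n => m n x) p ∂μ := by
  induction p using Polynomial.induction_on' with
  | add p q hp hq =>
    simp only [map_add]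
    exact ⟨hp.1.add hq.1, by rw [integral_add hp.1 hq.1, hp.2, hq.2]⟩
  | monomial n a =>
    simp only [momentFunctional_monomial]
    exact ⟨(hm n).const_mul a, (integral_const_mul _ _).symm⟩

lemma momentFunctional_comp_C_mul_X (m : ℕ → ℝ) (c : ℝ) (p : ℝ[X]) :
    momentFunctional m (p.comp (C c * X)) = momentFunctional (fun n => c ^ n * m n) p := by
  induction p using Polynomial.induction_on' with
  | add p q hp hq => simp only [Polynomial.add_comp, map_add, hp, hq]
  | monomial n a =>
    rw [monomial_comp, mul_pow, ← C_pow, ← mul_assoc, ← C_mul, C_mul_X_pow_eq_monomial,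
      momentFunctional_monomial, momentFunctional_monomial, mul_assoc]

variable {κ : ℕ} {ψ : ℝ → ℝ}

/-- A continuous function whose integral over every small ball is nonnegative is nonnegative at the
centre. -/
lemma nonneg_of_setIntegral_closedBall_nonneg (hψ_pos : ∀ x : ℝ, 0 < ψ x)
    (hψ_cont : Continuous ψ) {G : EuclideanSpace ℝ (Fin κ) → ℝ} (hG : Continuous G)
    (h : ∀ r : ℝ, 0 ≤ ∫ x in Metric.closedBall 0 r, G x ∂radialMeasure κ ψ) : 0 ≤ G 0 := by
  have := isLocallyFiniteMeasure_radialMeasure (κ := κ) hψ_pos hψ_cont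
  by_contra! hneg
  have hev : ∀ᶠ x in nhds (0 : EuclideanSpace ℝ (Fin κ)), G x < G 0 / 2 :=
    hG.continuousAt.eventually_lt_const (by linarith)
  obtain ⟨r, hr, hball⟩ := Metric.nhds_basis_closedBall.eventually_iff.1 hev
  have hfin : radialMeasure κ ψ (Metric.closedBall 0 r) ≠ ∞ :=
    (isCompact_closedBall _ _).measure_lt_top.ne
  have hpos : radialMeasure κ ψ (Metric.closedBall 0 r) ≠ 0 := by
    intro h0
    refine (Metric.measure_closedBall_pos volume (0 : EuclideanSpace ℝ (Fin κ)) hr).ne' ?_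
    refine withDensity_absolutelyContinuous' (measurable_radialDensity hψ_cont).aemeasurable
      (Eventually.of_forall fun x => ?_) h0
    exact (ENNReal.ofReal_pos.2 (inv_pos.2 (hψ_pos _))).ne'
  have hle : ∫ x in Metric.closedBall 0 r, G x ∂radialMeasure κ ψ ≤
      ∫ _ in Metric.closedBall 0 r, G 0 / 2 ∂radialMeasure κ ψ :=
    setIntegral_mono_on (hG.continuousOn.integrableOn_compact (isCompact_closedBall _ _))
      (integrableOn_const hfin) Metric.isClosed_closedBall.measurableSet fun x hx => (hball hx).le
  rw [setIntegral_const, smul_eq_mul] at hle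
  have hreal : 0 < (radialMeasure κ ψ).real (Metric.closedBall 0 r) :=
    ENNReal.toReal_pos hpos hfin
  nlinarith [h r]

/-- An invertible affine map, as a homeomorphism. -/
lemma exists_homeomorph_affine {A : EuclideanSpace ℝ (Fin κ) →L[ℝ] EuclideanSpace ℝ (Fin κ)}
    (hA : IsUnit A) (a : EuclideanSpace ℝ (Fin κ)) :
    ∃ (θ : EuclideanSpace ℝ (Fin κ) ≃ₜ EuclideanSpace ℝ (Fin κ)) (c : ℝ), 0 < c ∧
      (∀ x, θ x = A x + a) ∧ Measure.map θ volume = ENNReal.ofReal c • volume := by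
  have hdet : LinearMap.det (A : EuclideanSpace ℝ (Fin κ) →ₗ[ℝ] EuclideanSpace ℝ (Fin κ)) ≠ 0 := by
    refine (LinearMap.isUnit_det _ ?_).ne_zero
    exact hA.map (ContinuousLinearMap.toLinearMapRingHom (R₁ := ℝ) (M₁ := EuclideanSpace ℝ (Fin κ)))
  let e : EuclideanSpace ℝ (Fin κ) ≃L[ℝ] EuclideanSpace ℝ (Fin κ) :=
    ContinuousLinearEquiv.unitsEquiv ℝ _ hA.unit
  refine ⟨e.toHomeomorph.trans (Homeomorph.addRight a), |(LinearMap.det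
    (A : EuclideanSpace ℝ (Fin κ) →ₗ[ℝ] EuclideanSpace ℝ (Fin κ)))⁻¹|, by positivity,
    fun x => rfl, ?_⟩
  have h1 := Measure.map_linearMap_addHaar_eq_smul_addHaar volume hdet
  have h2 : ⇑(e.toHomeomorph.trans (Homeomorph.addRight a)) = (fun x => x + a) ∘ A := rfl
  rw [h2, ← Measure.map_map (by fun_prop) A.continuous.measurable]
  rw [ContinuousLinearMap.coe_coe] at h1
  rw [h1, Measure.map_smul, map_add_right_eq_self]

lemma map_iterate_volume {θ : EuclideanSpace ℝ (Fin κ) ≃ₜ EuclideanSpace ℝ (Fin κ)} {c : ℝ}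
    (hc : 0 ≤ c) (hθ : Measure.map θ volume = ENNReal.ofReal c • volume) (n : ℕ) :
    Measure.map (θ ^ n : EuclideanSpace ℝ (Fin κ) ≃ₜ EuclideanSpace ℝ (Fin κ)) volume =
      ENNReal.ofReal (c ^ n) • volume := by
  induction n with
  | zero =>
    rw [pow_zero, pow_zero, ENNReal.ofReal_one, one_smul]
    exact Measure.map_id
  | succ n ih =>
    have h : ((θ ^ (n + 1) : EuclideanSpace ℝ (Fin κ) ≃ₜ EuclideanSpace ℝ (Fin κ)) :
        EuclideanSpace ℝ (Fin κ) → EuclideanSpace ℝ (Fin κ)) = (θ ^ n : _ ≃ₜ _) ∘ θ := by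
      rw [pow_succ]
      rfl
    rw [h, ← Measure.map_map (θ ^ n).continuous.measurable θ.continuous.measurable, hθ,
      Measure.map_smul, ih, smul_smul, ← ENNReal.ofReal_mul hc, pow_succ']

lemma coe_homeomorph_pow {X : Type*} [TopologicalSpace X] (θ : X ≃ₜ X) (n : ℕ) :
    ⇑(θ ^ n) = θ^[n] := by
  induction n with
  | zero => rfl
  | succ n ih => rw [pow_succ, Function.iterate_succ, ← ih]; rfl

/-- Cosubnormality of the composition operator with symbol `x ↦ A x + a` makes `n ↦ ψ (n ‖a‖)`
positive definite when `A a = a`. -/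
lemma CosubnormalAffineComposition.momentFunctional_nonneg (hψ_pos : ∀ x : ℝ, 0 < ψ x)
    (hψ_cont : Continuous ψ) {A : EuclideanSpace ℝ (Fin κ) →L[ℝ] EuclideanSpace ℝ (Fin κ)}
    (hA : IsUnit A) {a : EuclideanSpace ℝ (Fin κ)} (ha : A a = a)
    (h : CosubnormalAffineComposition ψ A a) (q : ℝ[X]) :
    0 ≤ momentFunctional (fun n => ψ (n * ‖a‖)) (q * q) := by
  obtain ⟨C₀, hC, hsub⟩ := h
  obtain ⟨θ, c, hc, hθ, hvol⟩ := exists_homeomorph_affine hA a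
  have hθ' : (fun x => A x + a) = θ := funext fun x => (hθ x).symm
  rw [hθ'] at hC
  have := isLocallyFiniteMeasure_radialMeasure (κ := κ) hψ_pos hψ_cont
  -- The integral of `m n` over a closed ball is the squared norm of the `n`-th power of the adjoint
  -- at its indicator.
  set m : ℕ → EuclideanSpace ℝ (Fin κ) → ℝ := fun n x => c ^ n * (ψ ‖θ^[n] x‖ / ψ ‖x‖) with hm
  have hmc : ∀ n, Continuous (m n) := fun n =>
    continuous_const.mul ((hψ_cont.comp (θ.continuous.iterate n).norm).div
      (hψ_cont.comp continuous_norm) fun _ => (hψ_pos _).ne')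
  have hmain : ∀ q : ℝ[X], 0 ≤ momentFunctional (fun n => m n 0) (q * q) := by
    intro q
    refine nonneg_of_setIntegral_closedBall_nonneg hψ_pos hψ_cont
      (continuous_momentFunctional hmc (q * q)) fun r => ?_
    have hB := isCompact_closedBall (0 : EuclideanSpace ℝ (Fin κ)) r
    have hμB : radialMeasure κ ψ (Metric.closedBall 0 r) ≠ ∞ := hB.measure_lt_top.ne
    rw [← (momentFunctional_integral
      (fun n => (hmc n).continuousOn.integrableOn_compact hB) (q * q)).2]
    have key := hsub.momentFunctional_nonneg (indicatorConstLp 2 hB.measurableSet hμB 1) q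
    convert key using 4 with n
    rw [← star_eq_adjoint, ← star_pow, star_eq_adjoint]
    have hCn := hC.pow n
    rw [← coe_homeomorph_pow] at hCn
    rw [norm_adjoint_indicator_sq hψ_pos hψ_cont (θ ^ n) (pow_pos hc n)
      (map_iterate_volume hc.le hvol n) hB hμB hCn]
    simp only [hm, coe_homeomorph_pow]
  have hiter : ∀ n : ℕ, θ^[n] 0 = n • a := by
    intro n
    induction n with
    | zero => simp
    | succ n ih => rw [Function.iterate_succ_apply', ih, hθ, map_nsmul, ha, succ_nsmul]
  -- Rescaling `X` by `c⁻¹` removes the factor `c ^ n` and keeps squares.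
  have h1 := hmain (q.comp (C c⁻¹ * X))
  rw [← mul_comp, momentFunctional_comp_C_mul_X] at h1
  have h2 : (fun n => c⁻¹ ^ n * m n 0) = fun n : ℕ => ψ (n * ‖a‖) * (ψ 0)⁻¹ := by
    funext n
    have hn : ‖(n • a : EuclideanSpace ℝ (Fin κ))‖ = n * ‖a‖ := by
      rw [← Nat.cast_smul_eq_nsmul ℝ, norm_smul, Real.norm_natCast]
    simp only [hm, hiter, hn, norm_zero]
    rw [← mul_assoc, ← mul_pow, inv_mul_cancel₀ hc.ne', one_pow, one_mul, div_eq_mul_inv]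
  rw [h2] at h1
  have h3 : ∀ p : ℝ[X], momentFunctional (fun n : ℕ => ψ (n * ‖a‖) * (ψ 0)⁻¹) p =
      momentFunctional (fun n => ψ (n * ‖a‖)) p * (ψ 0)⁻¹ := by
    intro p
    induction p using Polynomial.induction_on' with
    | add p q hp hq => rw [map_add, map_add, add_mul, hp, hq]
    | monomial n b => rw [momentFunctional_monomial, momentFunctional_monomial, mul_assoc]
  rw [h3] at h1
  exact nonneg_of_mul_nonneg_left h1 (inv_pos.2 (hψ_pos 0))

/-- A map whose push-forward of `μ` is dominated by a multiple of `μ` induces a bounded composition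
operator. -/
lemma exists_isCompositionOp {X : Type*} [MeasurableSpace X] {μ : Measure X} {T : X → X}
    (hT : Measurable T) {K : ℝ≥0∞} (hK : K ≠ ∞) (h : Measure.map T μ ≤ K • μ) :
    ∃ C : Lp ℂ 2 μ →L[ℂ] Lp ℂ 2 μ, IsCompositionOp μ T C := by
  have hmem : ∀ f : X → ℂ, MemLp f 2 μ → MemLp (f ∘ T) 2 μ := fun f hf =>
    (hf.of_measure_le_smul hK h).comp_of_map hT.aemeasurable
  have hae : ∀ f g : X → ℂ, f =ᵐ[μ] g → f ∘ T =ᵐ[μ] g ∘ T := fun f g hfg =>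
    ae_of_ae_map hT.aemeasurable (Measure.absolutelyContinuous_of_le_smul h hfg)
  let L : Lp ℂ 2 μ →ₗ[ℂ] Lp ℂ 2 μ :=
    { toFun := fun f => (hmem f (Lp.memLp f)).toLp _
      map_add' := fun f g => by
        rw [← MemLp.toLp_add, MemLp.toLp_eq_toLp_iff]
        exact hae _ _ (Lp.coeFn_add f g)
      map_smul' := fun b f => by
        rw [RingHom.id_apply, ← MemLp.toLp_const_smul, MemLp.toLp_eq_toLp_iff]
        exact hae _ _ (Lp.coeFn_smul b f) }
  refine ⟨L.mkContinuous (K ^ (1 / (2 : ℝ≥0∞)).toReal).toReal fun f => ?_, fun f hf => ?_⟩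
  · change ‖(hmem f (Lp.memLp f)).toLp _‖ ≤ _
    rw [Lp.norm_toLp, Lp.norm_def, ← ENNReal.toReal_mul]
    refine ENNReal.toReal_mono ?_ ?_
    · exact ENNReal.mul_ne_top (ENNReal.rpow_ne_top_of_nonneg ENNReal.toReal_nonneg hK)
        (Lp.eLpNorm_ne_top f)
    · rw [← eLpNorm_map_measure ((Lp.memLp f).of_measure_le_smul hK h).aestronglyMeasurable
        hT.aemeasurable]
      exact eLpNorm_le_of_measure_le_smul h
  · exact (MemLp.coeFn_toLp (hmem _ (Lp.memLp _))).trans (hae _ _ hf.coeFn_toLp)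

lemma boundedAffineComposition_of_shift_le (hψ_pos : ∀ x : ℝ, 0 < ψ x) (hψ_cont : Continuous ψ)
    (hmono : ∀ x y : ℝ, 0 ≤ x → x ≤ y → ψ x ≤ ψ y)
    {A : EuclideanSpace ℝ (Fin κ) →L[ℝ] EuclideanSpace ℝ (Fin κ)} (hA : IsUnit A)
    (hA_norm : ‖A‖ ≤ 1) (a : EuclideanSpace ℝ (Fin κ)) {K : ℝ} (hK : 0 < K)
    (hshift : ∀ x ≥ 0, ψ (x + ‖a‖) ≤ K * ψ x) : BoundedAffineComposition ψ A a := by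
  obtain ⟨θ, c, hc, hθ, hvol⟩ := exists_homeomorph_affine hA a
  have hθ' : (fun x => A x + a) = θ := funext fun x => (hθ x).symm
  rw [BoundedAffineComposition, hθ']
  -- `K` bounds the ratio of the densities at `x` and `θ x`; `c` is the factor by which `θ` rescales
  -- Lebesgue measure.
  refine exists_isCompositionOp (K := ENNReal.ofReal K * ENNReal.ofReal c)
    θ.continuous.measurable (by finiteness) (Measure.le_iff.2 fun s hs => ?_)
  have hle : ∀ x, ENNReal.ofReal (ψ ‖x‖)⁻¹ ≤ ENNReal.ofReal K * ENNReal.ofReal (ψ ‖θ x‖)⁻¹ := by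
    intro x
    rw [← ENNReal.ofReal_mul hK.le]
    refine ENNReal.ofReal_le_ofReal ?_
    rw [← div_eq_mul_inv, inv_eq_one_div, div_le_div_iff₀ (hψ_pos _) (hψ_pos _), one_mul]
    refine (hmono _ (‖x‖ + ‖a‖) (norm_nonneg _) ?_).trans (hshift _ (norm_nonneg _))
    rw [hθ]
    refine (norm_add_le _ _).trans ?_
    gcongr
    exact (A.le_of_opNorm_le hA_norm x).trans_eq (one_mul _)
  have hmeas := measurable_radialDensity (κ := κ) hψ_cont
  have hsθ : MeasurableSet (θ ⁻¹' s) := θ.continuous.measurable hs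
  rw [Measure.map_apply θ.continuous.measurable hs, Measure.smul_apply, radialMeasure,
    withDensity_apply _ hsθ, withDensity_apply _ hs, smul_eq_mul]
  calc ∫⁻ x in θ ⁻¹' s, ENNReal.ofReal (ψ ‖x‖)⁻¹
      ≤ ∫⁻ x in θ ⁻¹' s, ENNReal.ofReal K * ENNReal.ofReal (ψ ‖θ x‖)⁻¹ := lintegral_mono hle
    _ = ENNReal.ofReal K * ∫⁻ x in θ ⁻¹' s, ENNReal.ofReal (ψ ‖θ x‖)⁻¹ :=
        lintegral_const_mul _ (hmeas.comp θ.continuous.measurable)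
    _ = ENNReal.ofReal K * ∫⁻ y in s, ENNReal.ofReal (ψ ‖y‖)⁻¹ ∂(Measure.map θ volume) := by
        rw [setLIntegral_map hs hmeas θ.continuous.measurable]
    _ = _ := by
        rw [hvol, Measure.restrict_smul, lintegral_smul_measure, smul_eq_mul, mul_assoc]

end AffineSymbol

/-! ### The main theorem -/

theorem proposition3p2p6 (κ : ℕ) (ψ : ℝ → ℝ)
    (hψ_pos : ∀ x : ℝ, 0 < ψ x) (hψ_cont : Continuous ψ) (hψ_even : ∀ x : ℝ, ψ (-x) = ψ x)
    (hψ_mem : MemEntireClass ψ)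
    (hψ_limsup : limsup (fun x : ℝ => ((deriv ψ x / ψ x : ℝ) : EReal)) atTop < ⊤)
    (A : EuclideanSpace ℝ (Fin κ) →L[ℝ] EuclideanSpace ℝ (Fin κ))
    (hA : IsUnit A) (hA_norm : ‖A‖ = 1) :
    (∀ a : EuclideanSpace ℝ (Fin κ), a ∈ (1 - A).ker → BoundedAffineComposition ψ A a) ∧
    (((∃ a : ℕ → EuclideanSpace ℝ (Fin κ),
          (∀ k : ℕ, 1 ≤ k → a k ∈ (1 - A).ker ∧ a k ≠ 0) ∧ SquigglyToZero a ∧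
          ∀ k : ℕ, 1 ≤ k → CosubnormalAffineComposition ψ A (a k)) ∨
        (∃ ε : ℝ, 0 < ε ∧ ∃ a₀ : EuclideanSpace ℝ (Fin κ), a₀ ∈ (1 - A).ker ∧ a₀ ≠ 0 ∧
          ∀ t : ℝ, 0 < |t| → |t| < ε → CosubnormalAffineComposition ψ A (t • a₀))) →
      IsCompactCoshTransform ψ) := by
  obtain ⟨α, hα, hs⟩ := hψ_mem.exists_hasSum
  have hmono : ∀ x y : ℝ, 0 ≤ x → x ≤ y → ψ x ≤ ψ y := fun _ _ hx hxy =>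
    monotoneOn_of_hasSum hα hs hx hxy
  refine ⟨fun a _ => ?_, fun h => ?_⟩
  · obtain ⟨K, hK, hshift⟩ := exists_shift_le_mul hψ_pos hmono (differentiable_of_hasSum hs)
      hψ_limsup (norm_nonneg a)
    exact boundedAffineComposition_of_shift_le hψ_pos hψ_cont hmono hA hA_norm.le a hK hshift
  -- All that is used of (i) or (ii) is the existence of arbitrarily short nonzero translations. In
  -- (i), `1 / (k ‖a k‖) ≥ 1` gives `‖a k‖ ≤ 1 / k`.
  · have hsmall : ∀ δ > 0, ∃ a : EuclideanSpace ℝ (Fin κ), a ∈ (1 - A).ker ∧ 0 < ‖a‖ ∧ ‖a‖ < δ ∧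
        CosubnormalAffineComposition ψ A a := by
      intro δ hδ
      rcases h with ⟨a, ha, hsq, hco⟩ | ⟨ε, hε, a₀, ha₀, hne, hco⟩
      · obtain ⟨n, hn⟩ := exists_nat_one_div_lt hδ
        obtain ⟨hker, hne⟩ := ha (n + 1) (by omega)
        refine ⟨a (n + 1), hker, norm_pos_iff.2 hne, ?_, hco _ (by omega)⟩
        obtain ⟨s, hs1, hs⟩ := hsq (n + 1) (by omega)
        have hpos : 0 < ‖a (n + 1)‖ := norm_pos_iff.2 hne
        refine lt_of_le_of_lt ?_ hn
        have hs1' : (1 : ℝ) ≤ s := by exact_mod_cast hs1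
        rw [← hs, le_div_iff₀ (by positivity), one_mul] at hs1'
        rw [le_div_iff₀ (by positivity)]
        push_cast at hs1'
        linarith
      · have hpos : 0 < ‖a₀‖ := norm_pos_iff.2 hne
        obtain ⟨t, ht0, ht⟩ := exists_between (lt_min hε (div_pos hδ hpos))
        rw [lt_min_iff, lt_div_iff₀ hpos] at ht
        refine ⟨t • a₀, Submodule.smul_mem _ t ha₀, ?_, ?_, hco t ?_ ?_⟩
        · rw [norm_smul, Real.norm_of_nonneg ht0.le]; positivity
        · rw [norm_smul, Real.norm_of_nonneg ht0.le]; exact ht.2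
        · rw [abs_of_pos ht0]; exact ht0
        · rw [abs_of_pos ht0]; exact ht.1
    have hfreq : ∃ᶠ h in nhdsWithin (0 : ℝ) (Set.Ioi 0),
        ∀ q : Polynomial ℝ, 0 ≤ momentFunctional (fun k => ψ (k * h)) (q * q) := by
      rw [(nhdsGT_basis (0 : ℝ)).frequently_iff]
      intro δ hδ
      obtain ⟨a, hker, h0, h1, hco⟩ := hsmall δ hδ
      refine ⟨‖a‖, ⟨h0, h1⟩, hco.momentFunctional_nonneg hψ_pos hψ_cont hA ?_⟩
      have : a - A a = 0 := hker
      exact (sub_eq_zero.1 this).symm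
    obtain ⟨c, R, hR, hb⟩ := exists_factorial_mul_le hψ_pos hα hs hψ_limsup
    exact isCompactCoshTransform_of_nonneg_on_squares hα hs hψ_even hR hb
      (momentFunctional_factorial_mul_nonneg hα hs hfreq)
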